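/- A \emph{one-way deterministic Turing machine} (DTM) has finitely many states $Q$ with an initial state $q_0$ and a set $F\subseteq Q$ of final states, a finite input alphabet $\Sigma$, a finite worktape alphabet $\Gamma$ containing a blank symbol, a one-way read-only input tape holding a word $w\in\Sigma^*$ followed by a right end-marker $\triangleleft$, and one two-way infinite read/write worktape, initially blank. Its finite set $\delta$ of transitions is contained in $Q\times(\Sigma\cup\{\lambda,\triangleleft\})\times\Gamma\times Q\times\Gamma\times\{\mathrm L,\mathrm S,\mathrm R\}$; a transition $(q,a,c,q',d,D)$ applies in state $q$ when $c$ is scanned on the worktape and the remaining input begins with $a$ (for $a=\lambda$ no input is read); it consumes $a$, enters state $q'$, replaces $c$ by $d$ and moves the worktape head left, not at all, or right. Deterministic means that no two distinct transitions apply to a common configuration. A computation on $w$ is a finite sequence of configurations $c_0\vdash\cdots\vdash c_n$ starting in the initial configuration on $w\triangleleft$; it is accepting if $c_n$ has a state in $F$ and all of $w\triangleleft$ has been read. Let $i_j\in\mathbb Z$ be the position of the worktape head in $c_j$ ($0\le j\le n$). The computation makes a \emph{turn} in $c_j$ ($1\le j\le n$) if $i_j\neq i_{j-1}$, there is a largest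 $l\in\{0,\dots,j-1\}$ with $i_l\neq i_{j-1}$, and $i_j,i_l$ are both smaller or both larger than $i_{j-1}$. For an integer $k\ge 0$, a machine is \begin{itemize} \item \emph{$k$-turn} if every accepting computation (on any input word) makes at most $k$ turns; \item \emph{$k$-crossing} if in every accepting computation, for every $r\in\mathbb Z$, the number of $j<n$ with $\{i_j,i_{j+1}\}=\{r,r+1\}$ is at most $k$; \item \emph{$k$-visit} if in every accepting computation, for every $r\in\mathbb Z$, the number of $j\in\{0,\dots,n\}$ with $i_j=r$ is at most $k$. \end{itemize} It is \emph{finite-turn} (respectively \emph{finite-crossing}, \emph{finite-visit}) if it is $k$-turn (respectively $k$-crossing, $k$-visit) for some $k\ge 0$. \textbf{Theorem.} Each of the following six problems, in which a DTM $M$ is given, is undecidable: whether $M$ is $0$-turn; whether $M$ is $0$-crossing; whether $M$ is $1$-visit; whether $M$ is finite-turn; whether $M$ is finite-crossing; whether $M$ is finite-visit. -/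

import Mathlib

/-- A direction of the worktape head: left, stay, or right. -/
inductive HeadMove where
  | left
  | stay
  | right
  deriving DecidableEq

namespace HeadMove

/-- The change of the worktape address caused by a move. -/
def shift : HeadMove → ℤ
  | left => -1
  | stay => 0
  | right => 1

/-- The effect of a move on a two-way infinite tape with a distinguished scanned cell. -/
def apply : HeadMove → Turing.Tape ℕ → Turing.Tape ℕ
  | left, T => T.move Turing.Dir.left
  | stay, T => T
  | right, T => T.move Turing.Dir.right

/-- The three moves, listed by the three elements of `Option Bool`. -/
def equivOptionBool : HeadMove ≃ Option Bool where
  toFun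
    | left => some false
    | stay => none
    | right => some true
  invFun
    | some false => left
    | none => stay
    | some true => right
  left_inv := by intro m; cases m <;> rfl
  right_inv := by
    intro o
    match o with
    | some false => rfl
    | none => rfl
    | some true => rfl

instance : Primcodable HeadMove := Primcodable.ofEquiv _ equivOptionBool

end HeadMove

/-- A transition of a one-way Turing machine with one worktape. States, input letters and worktape
symbols are named by natural numbers. The component `read` is `none` if no input is read,
`some none` if the right end-marker is read, and `some (some a)` if the input letter `a` is read. -/
structure TMTransition where
  source : ℕ
  read : Option (Option ℕ)
  scan : ℕ
  target : ℕ
  write : ℕ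
  move : HeadMove
  deriving DecidableEq

namespace TMTransition

/-- A transition as a tuple. -/
def equivProd :
    TMTransition ≃ ℕ × Option (Option ℕ) × ℕ × ℕ × ℕ × HeadMove where
  toFun t := (t.source, t.read, t.scan, t.target, t.write, t.move)
  invFun p := ⟨p.1, p.2.1, p.2.2.1, p.2.2.2.1, p.2.2.2.2.1, p.2.2.2.2.2⟩
  left_inv _ := rfl
  right_inv _ := rfl

instance : Primcodable TMTransition := Primcodable.ofEquiv _ equivProd

end TMTransition

/-- A finite description of a one-way nondeterministic Turing machine with a one-way read-only
input tape and one two-way read/write worktape. The states are the numbers below `numStates`, the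
input letters are the numbers below `numInput`, the worktape symbols are the numbers below
`numTape`, and the blank symbol is `0`. The lists `final` and `delta` stand for the sets of their
members. (That the components lie in these ranges is the predicate `WellFormed` below.) -/
structure OneWayTM where
  numStates : ℕ
  numInput : ℕ
  numTape : ℕ
  start : ℕ
  final : List ℕ
  delta : List TMTransition

/-- A configuration: the state, the remaining input (a letter `a` is written `some a` and the right
end-marker is written `none`), the worktape with the scanned cell (almost all cells are blank), and
the worktape address of the scanned cell. -/
structure TMConfig where
  state : ℕ
  input : List (Option ℕ)
  tape : Turing.Tape ℕ
  address : ℤ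

/-- For a computation whose configurations have the addresses `i 0, i 1, …`: a turn is made in the
`j`-th configuration, `1 ≤ j`, if the head moves left from `i (j - 1)` to `i j` and the last earlier
position different from `i (j - 1)` lies to the left of `i (j - 1)`, or if the head moves right and
that last position lies to the right. -/
def MakesTurn (i : ℕ → ℤ) (j : ℕ) : Prop :=
  (i j < i (j - 1) ∧ ∃ l < j, i l < i (j - 1) ∧ ∀ m, l < m → m < j → i m = i (j - 1)) ∨
  (i (j - 1) < i j ∧ ∃ l < j, i (j - 1) < i l ∧ ∀ m, l < m → m < j → i m = i (j - 1))

open Classical in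
/-- The number of turns in a computation of `n` steps with addresses `i 0, …, i n`. -/
noncomputable def numTurns (i : ℕ → ℤ) (n : ℕ) : ℕ :=
  ((Finset.Icc 1 n).filter (fun j => MakesTurn i j)).card

/-- The number of crossings of the boundary between the cells `r` and `r + 1` in a computation of
`n` steps with addresses `i 0, …, i n`. -/
def numCrossings (i : ℕ → ℤ) (n : ℕ) (r : ℤ) : ℕ :=
  ((Finset.range n).filter
    (fun j => (i j = r ∧ i (j + 1) = r + 1) ∨ (i j = r + 1 ∧ i (j + 1) = r))).card

/-- The number of visits to the cell `r` in a computation of `n` steps with addresses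
`i 0, …, i n`. -/
def numVisits (i : ℕ → ℤ) (n : ℕ) (r : ℤ) : ℕ :=
  ((Finset.range (n + 1)).filter (fun j => i j = r)).card

namespace OneWayTM

/-- The state set contains the initial state and the final states, the worktape alphabet contains
the blank, and every transition is between states and symbols of the machine. -/
def WellFormed (M : OneWayTM) : Prop :=
  0 < M.numTape ∧ M.start < M.numStates ∧ (∀ q ∈ M.final, q < M.numStates) ∧
  ∀ t ∈ M.delta, t.source < M.numStates ∧ t.target < M.numStates ∧
    t.scan < M.numTape ∧ t.write < M.numTape ∧ ∀ a, t.read = some (some a) → a < M.numInput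

/-- No two different transitions can apply to the same configuration: two transitions with the same
state and the same scanned worktape symbol are equal, unless they read two different symbols of the
input tape. -/
def Deterministic (M : OneWayTM) : Prop :=
  ∀ t ∈ M.delta, ∀ u ∈ M.delta, t.source = u.source → t.scan = u.scan →
    (t.read = u.read ∨ t.read = none ∨ u.read = none) → t = u

/-- One step `c ⊢ c'` of `M`. -/
def Step (M : OneWayTM) (c c' : TMConfig) : Prop :=
  ∃ t ∈ M.delta, t.source = c.state ∧ t.scan = c.tape.head ∧ c.input = t.read.toList ++ c'.input ∧
    c'.state = t.target ∧ c'.tape = t.move.apply (c.tape.write t.write) ∧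
    c'.address = c.address + t.move.shift

/-- The initial configuration on the input word `w`, which is followed by the end-marker. -/
def initial (M : OneWayTM) (w : List ℕ) : TMConfig where
  state := M.start
  input := w.map some ++ [none]
  tape := Turing.Tape.mk₁ []
  address := 1

/-- The configurations `c 0, …, c n` form an accepting computation of `M` on the input word `w`
(the values of `c` beyond `n` are irrelevant). -/
def IsAcceptingComputation (M : OneWayTM) (w : List ℕ) (n : ℕ) (c : ℕ → TMConfig) : Prop :=
  (∀ a ∈ w, a < M.numInput) ∧ c 0 = M.initial w ∧ (∀ j < n, M.Step (c j) (c (j + 1))) ∧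
    (c n).state ∈ M.final ∧ (c n).input = []

/-- `M` is `k`-turn: every accepting computation makes at most `k` turns. -/
def IsKTurn (M : OneWayTM) (k : ℕ) : Prop :=
  ∀ w n c, M.IsAcceptingComputation w n c → numTurns (fun j => (c j).address) n ≤ k

/-- `M` is `k`-crossing: every accepting computation crosses each boundary between adjacent cells
at most `k` times. -/
def IsKCrossing (M : OneWayTM) (k : ℕ) : Prop :=
  ∀ w n c, M.IsAcceptingComputation w n c →
    ∀ r : ℤ, numCrossings (fun j => (c j).address) n r ≤ k

/-- `M` is `k`-visit: every accepting computation visits each cell at most `k` times. -/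
def IsKVisit (M : OneWayTM) (k : ℕ) : Prop :=
  ∀ w n c, M.IsAcceptingComputation w n c →
    ∀ r : ℤ, numVisits (fun j => (c j).address) n r ≤ k

/-- `M` is `k`-turn for some `k`. -/
def IsFiniteTurn (M : OneWayTM) : Prop := ∃ k, M.IsKTurn k

/-- `M` is `k`-crossing for some `k`. -/
def IsFiniteCrossing (M : OneWayTM) : Prop := ∃ k, M.IsKCrossing k

/-- `M` is `k`-visit for some `k`. -/
def IsFiniteVisit (M : OneWayTM) : Prop := ∃ k, M.IsKVisit k

/-- A machine description as a tuple. -/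
def equivProd :
    OneWayTM ≃ ℕ × ℕ × ℕ × ℕ × List ℕ × List TMTransition where
  toFun M := (M.numStates, M.numInput, M.numTape, M.start, M.final, M.delta)
  invFun p := ⟨p.1, p.2.1, p.2.2.1, p.2.2.2.1, p.2.2.2.2.1, p.2.2.2.2.2⟩
  left_inv _ := rfl
  right_inv _ := rfl

instance : Primcodable OneWayTM := Primcodable.ofEquiv _ equivProd

end OneWayTM

section Coding

open Primrec

theorem TMTransition.primrec_equivProd : Primrec TMTransition.equivProd := Primrec.of_equiv

theorem TMTransition.primrec_source : Primrec TMTransition.source :=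
  fst.comp primrec_equivProd

theorem TMTransition.primrec_read : Primrec TMTransition.read :=
  (fst.comp snd).comp primrec_equivProd

theorem TMTransition.primrec_scan : Primrec TMTransition.scan :=
  (fst.comp (snd.comp snd)).comp primrec_equivProd

theorem TMTransition.primrec_target : Primrec TMTransition.target :=
  (fst.comp (snd.comp (snd.comp snd))).comp primrec_equivProd

theorem TMTransition.primrec_write : Primrec TMTransition.write :=
  (fst.comp (snd.comp (snd.comp (snd.comp snd)))).comp primrec_equivProd

theorem OneWayTM.primrec_equivProd : Primrec OneWayTM.equivProd := Primrec.of_equiv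

theorem OneWayTM.primrec_numStates : Primrec OneWayTM.numStates :=
  ((fst).comp primrec_equivProd).of_eq fun _ => rfl

theorem OneWayTM.primrec_numInput : Primrec OneWayTM.numInput :=
  (((fst.comp snd)).comp primrec_equivProd).of_eq fun _ => rfl

theorem OneWayTM.primrec_numTape : Primrec OneWayTM.numTape :=
  (((fst.comp (snd.comp snd))).comp primrec_equivProd).of_eq fun _ => rfl

theorem OneWayTM.primrec_start : Primrec OneWayTM.start :=
  (((fst.comp (snd.comp (snd.comp snd)))).comp primrec_equivProd).of_eq fun _ => rfl

theorem OneWayTM.primrec_final : Primrec OneWayTM.final :=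
  (((fst.comp (snd.comp (snd.comp (snd.comp snd))))).comp primrec_equivProd).of_eq fun _ => rfl

theorem OneWayTM.primrec_delta : Primrec OneWayTM.delta :=
  (((snd.comp (snd.comp (snd.comp (snd.comp snd))))).comp primrec_equivProd).of_eq fun _ => rfl

/-- Well-formedness is a primitive recursive property of descriptions. -/
theorem OneWayTM.primrecPred_wellFormed : PrimrecPred OneWayTM.WellFormed := by
  have hfin : PrimrecPred fun M : OneWayTM => ∀ q ∈ M.final, q < M.numStates :=
    PrimrecRel.comp (nat_lt.forall_mem_list) primrec_final primrec_numStates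
  have hread : PrimrecRel fun (t : TMTransition) (M : OneWayTM) =>
      ∀ a, t.read = some (some a) → a < M.numInput := by
    have h0 : PrimrecPred fun p : TMTransition × OneWayTM =>
        ((p.1.read.getD none).getD 0 < p.2.numInput) ∨
          (p.1.read = none ∨ p.1.read = some none) := by
      refine PrimrecPred.or ?_ (PrimrecPred.or ?_ ?_)
      · exact nat_lt.comp (option_getD.comp
          (option_getD.comp (TMTransition.primrec_read.comp fst) (const none)) (const 0))
          (primrec_numInput.comp snd)
      · exact Primrec.eq.comp (TMTransition.primrec_read.comp fst) (const none)
      · exact Primrec.eq.comp (TMTransition.primrec_read.comp fst) (const (some none))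
    refine h0.of_eq ?_
    rintro ⟨t, M⟩
    rcases h : t.read with _ | _ | a <;> simp [h]
  have hdelta : PrimrecRel fun (t : TMTransition) (M : OneWayTM) =>
      t.source < M.numStates ∧ t.target < M.numStates ∧ t.scan < M.numTape ∧
        t.write < M.numTape ∧ ∀ a, t.read = some (some a) → a < M.numInput := by
    refine PrimrecPred.and ?_ (PrimrecPred.and ?_ (PrimrecPred.and ?_ (PrimrecPred.and ?_ hread)))
    · exact nat_lt.comp (TMTransition.primrec_source.comp fst) (primrec_numStates.comp snd)
    · exact nat_lt.comp (TMTransition.primrec_target.comp fst) (primrec_numStates.comp snd)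
    · exact nat_lt.comp (TMTransition.primrec_scan.comp fst) (primrec_numTape.comp snd)
    · exact nat_lt.comp (TMTransition.primrec_write.comp fst) (primrec_numTape.comp snd)
  exact (nat_lt.comp (const 0) primrec_numTape).and
    ((nat_lt.comp primrec_start primrec_numStates).and
      (hfin.and (hdelta.forall_mem_list.comp primrec_delta Primrec.id)))

/-- Determinism is a primitive recursive property of descriptions. -/
theorem OneWayTM.primrecPred_deterministic : PrimrecPred OneWayTM.Deterministic := by
  have hpair : PrimrecRel fun (u t : TMTransition) =>
      t.source = u.source → t.scan = u.scan →
        (t.read = u.read ∨ t.read = none ∨ u.read = none) → t = u := by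
    have h0 : PrimrecPred fun p : TMTransition × TMTransition =>
        ¬ (p.2.source = p.1.source) ∨ ¬ (p.2.scan = p.1.scan) ∨
          ¬ (p.2.read = p.1.read ∨ p.2.read = none ∨ p.1.read = none) ∨ p.2 = p.1 := by
      refine PrimrecPred.or (PrimrecPred.not ?_) (PrimrecPred.or (PrimrecPred.not ?_)
        (PrimrecPred.or (PrimrecPred.not (PrimrecPred.or ?_ (PrimrecPred.or ?_ ?_))) ?_))
      · exact Primrec.eq.comp (TMTransition.primrec_source.comp snd)
          (TMTransition.primrec_source.comp fst)
      · exact Primrec.eq.comp (TMTransition.primrec_scan.comp snd)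
          (TMTransition.primrec_scan.comp fst)
      · exact Primrec.eq.comp (TMTransition.primrec_read.comp snd)
          (TMTransition.primrec_read.comp fst)
      · exact Primrec.eq.comp (TMTransition.primrec_read.comp snd) (const none)
      · exact Primrec.eq.comp (TMTransition.primrec_read.comp fst) (const none)
      · exact Primrec.eq.comp snd fst
    refine h0.of_eq ?_
    rintro ⟨u, t⟩
    simp only
    tauto
  have h1 : PrimrecRel fun (t : TMTransition) (L : List TMTransition) => ∀ u ∈ L,
      t.source = u.source → t.scan = u.scan →
        (t.read = u.read ∨ t.read = none ∨ u.read = none) → t = u :=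
    hpair.forall_mem_list.comp snd fst
  exact h1.forall_mem_list.comp primrec_delta primrec_delta

end Coding

/-- The (descriptions of) one-way deterministic Turing machines. -/
def OneWayDTM : Type := {M : OneWayTM // M.WellFormed ∧ M.Deterministic}

noncomputable instance : Primcodable OneWayDTM :=
  letI : DecidablePred fun M : OneWayTM => M.WellFormed ∧ M.Deterministic := Classical.decPred _
  Primcodable.subtype
    (OneWayTM.primrecPred_wellFormed.and OneWayTM.primrecPred_deterministic)

/-! The six problems are settled by one reduction from a halting problem. A computable sequence of
deterministic machines `F k` ignores the input at the start, writes on the worktape a word depending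
on `k`, and simulates on it a fixed Turing machine. If the simulation halts, the head steps right
and back once for each input letter, and the machine accepts on the end-marker. If the simulation
does not halt, `F k` has no accepting computation, so all six properties hold vacuously. If it
halts, the input word of length `m` gives an accepting computation with at least `m` turns,
crossings of one boundary and visits to one cell, so all six fail. A decision procedure for any of
them would decide halting. The two directions are `simulator_exists_accepting` and
`simulator_not_accepting`. For `F` to be computable by inspection,
`TM0.exists_not_computable_halting` provides inputs `a₁ a₂ bᵏ`, so that `k` enters the transition
table only through `k` writing transitions. -/

open Turing

/-! ### Undecidable halting on inputs that are essentially unary -/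

theorem Partrec.exists_not_computable_dom :
    ∃ f : ℕ →. ℕ, Partrec f ∧ ¬ ComputablePred fun k => (f k).Dom := by
  refine ⟨fun k => Nat.Partrec.Code.eval (Denumerable.ofNat Nat.Partrec.Code k) 0, ?_, ?_⟩
  · exact Nat.Partrec.Code.eval_part.comp (Computable.ofNat _) (Computable.const 0)
  · intro h
    refine ComputablePred.halting_problem 0 ?_
    have := ComputablePred.computable_of_manyOneReducible
      (p := fun c : Nat.Partrec.Code => (Nat.Partrec.Code.eval c 0).Dom)
      ⟨Encodable.encode, Computable.encode, fun c => by simp⟩ h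
    exact this

/-- Powers of two are used because their binary numerals are constant up to one digit. The function
takes the logarithm by unbounded search, which diverges harmlessly elsewhere, and then applies a
function with undecidable domain. -/
theorem Partrec.exists_not_computable_dom_two_pow :
    ∃ f : ℕ →. ℕ, Partrec f ∧ ¬ ComputablePred fun k => (f (2 ^ k)).Dom := by
  obtain ⟨f, hf, hn⟩ := Partrec.exists_not_computable_dom
  have hpow : Primrec fun k : ℕ => 2 ^ k := by
    refine (Primrec.nat_rec' (f := fun k : ℕ => k) (g := fun _ => 1) (h := fun _ p => 2 * p.2)
      Primrec.id (Primrec.const 1) ?_).of_eq fun n => ?_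
    · exact Primrec.nat_mul.comp (Primrec.const 2) (Primrec.snd.comp Primrec.snd)
    · induction n with
      | zero => rfl
      | succ n ih => simp only [pow_succ] at ih ⊢; rw [← ih]; ring
  have hp : Partrec₂ fun (n k : ℕ) => Part.some (decide (2 ^ k = n)) := by
    have : PrimrecPred fun p : ℕ × ℕ => 2 ^ p.2 = p.1 :=
      Primrec.eq.comp (hpow.comp Primrec.snd) Primrec.fst
    exact this.decide.to_comp.partrec
  refine ⟨fun n => (Nat.rfind fun k => Part.some (decide (2 ^ k = n))) >>= f, ?_, ?_⟩
  · exact (Partrec.rfind hp).bind (hf.comp Computable.snd)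
  · convert hn using 3 with k
    have : (Nat.rfind fun j => Part.some (decide (2 ^ j = 2 ^ k))) = Part.some k := by
      refine Part.eq_some_iff.2 (Nat.mem_rfind.2 ⟨by simp, fun {m} hm => ?_⟩)
      simpa using hm.ne
    show ((Nat.rfind fun j => Part.some (decide (2 ^ j = 2 ^ k))).bind f).Dom ↔ _
    rw [this]
    exact iff_of_eq (congrArg Part.Dom (Part.bind_some k f))

/-- Numerals are written with the least significant digit first, so doubling prepends a `bit0`. -/
theorem Turing.PartrecToTM2.trNat_two_pow (k : ℕ) :
    PartrecToTM2.trNat (2 ^ k) =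
      List.replicate k PartrecToTM2.Γ'.bit0 ++ [PartrecToTM2.Γ'.bit1] := by
  have h : ∀ k : ℕ, ∃ p : PosNum, ((2 ^ k : ℕ) : Num) = Num.pos p ∧
      PartrecToTM2.trPosNum p =
        List.replicate k PartrecToTM2.Γ'.bit0 ++ [PartrecToTM2.Γ'.bit1] := by
    intro k
    induction k with
    | zero => exact ⟨1, by simp; rfl, rfl⟩
    | succ k ih =>
      obtain ⟨p, h1, h2⟩ := ih
      refine ⟨p.bit0, ?_, ?_⟩
      · rw [pow_succ, mul_two, Num.add_of_nat, h1, Num.bit0_of_bit0]; rfl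
      · rw [PartrecToTM2.trPosNum, h2]; rfl
  obtain ⟨p, h1, h2⟩ := h k
  rw [PartrecToTM2.trNat, h1, PartrecToTM2.trNum, h2]

/-- A fixed Turing machine with finitely many states whose halting problem is undecidable already on
the inputs consisting of two fixed symbols followed by copies of a third one. -/
theorem Turing.TM0.exists_not_computable_halting :
    ∃ (Γ : Type) (_ : Inhabited Γ) (_ : Fintype Γ) (Λ : Type) (_ : Inhabited Λ)
      (M : TM0.Machine Γ Λ) (S : Finset Λ) (a₁ a₂ b : Γ), TM0.Supports M (S : Set Λ) ∧
      ¬ ComputablePred fun k : ℕ => (TM0.eval M (a₁ :: a₂ :: List.replicate k b)).Dom := by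
  obtain ⟨f, hf, hn⟩ := Partrec.exists_not_computable_dom_two_pow
  obtain ⟨c, hc⟩ := ToPartrec.Code.exists_code (Nat.Partrec'.part_iff₁.2 hf)
  -- The machines start in the default state, so the default is chosen to be the entry point of the
  -- code `c`.
  let start : Inhabited PartrecToTM2.Λ' :=
    ⟨PartrecToTM2.trNormal c PartrecToTM2.Cont'.halt⟩
  let hK : Fintype PartrecToTM2.K' :=
    ⟨{.main, .rev, .aux, .stack}, by intro x; cases x <;> decide⟩
  let hσ : Inhabited (Option PartrecToTM2.Γ') := ⟨none⟩
  let M₁ := TM2to1.tr (K := PartrecToTM2.K') (Γ := fun _ => PartrecToTM2.Γ')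
    (σ := Option PartrecToTM2.Γ') PartrecToTM2.tr
  -- A cell of the one-tape machine holds one optional symbol for each stack and a flag marking the
  -- bottom. Initially only the main stack is nonempty, and it lies on the tape bottom first, so the
  -- numeral is reversed.
  let sym : PartrecToTM2.Γ' → ∀ _ : PartrecToTM2.K', Option PartrecToTM2.Γ' :=
    fun a => Function.update (fun _ => none) .main (some a)
  refine ⟨TM2to1.Γ' PartrecToTM2.K' fun _ => PartrecToTM2.Γ', inferInstance, inferInstance,
    TM1to0.Λ' M₁, inferInstance, TM1to0.tr M₁,
    TM1to0.trStmts M₁ (TM2to1.trSupp PartrecToTM2.tr (PartrecToTM2.codeSupp c .halt)),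
    (true, sym .cons), (false, sym .bit1), (false, sym .bit0), ?_, ?_⟩
  · exact TM1to0.tr_supports _ (TM2to1.tr_supports _ (PartrecToTM2.tr_supports c .halt))
  · convert hn using 3 with k
    have hinit : ((true, sym .cons) :: (false, sym .bit1) :: List.replicate k (false, sym .bit0)) =
        TM2to1.trInit (Γ := fun _ => PartrecToTM2.Γ') PartrecToTM2.K'.main
          (PartrecToTM2.trList [2 ^ k]) := by
      have hrev : (PartrecToTM2.trList [2 ^ k]).reverse = PartrecToTM2.Γ'.cons ::
          PartrecToTM2.Γ'.bit1 :: List.replicate k PartrecToTM2.Γ'.bit0 := by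
        simp [PartrecToTM2.trList, PartrecToTM2.trNat_two_pow]
      rw [TM2to1.trInit, hrev]
      exact congrArg (fun l => (true, sym .cons) :: (false, sym .bit1) :: l)
        (List.map_replicate (f := fun a => (false, sym a))).symm
    rw [TM1to0.tr_eval]
    erw [hinit, TM2to1.tr_eval_dom]
    have hstk : TM2.init (Γ := fun _ => PartrecToTM2.Γ') (σ := Option PartrecToTM2.Γ')
        PartrecToTM2.K'.main (PartrecToTM2.trList [2 ^ k]) = PartrecToTM2.init c [2 ^ k] := by
      simp only [TM2.init, PartrecToTM2.init]
      congr 1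
      funext x
      cases x <;> rfl
    have := PartrecToTM2.tr_eval c [2 ^ k]
    rw [← hstk] at this
    show (StateTransition.eval (TM2.step PartrecToTM2.tr) _).Dom ↔ _
    rw [this, hc ⟨[2 ^ k], rfl⟩]
    rfl

/-! ### The simulating machine: tape lemmas, transitions, determinism -/

namespace Turing.Tape

variable {Γ : Type*} [Inhabited Γ]

theorem mk₁_nil_eq_mk₁_default : (Tape.mk₁ [] : Tape Γ) = Tape.mk₁ [default] := by
  simp only [Tape.mk₁, Tape.mk₂, Tape.mk', ListBlank.head_mk, ListBlank.tail_mk]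
  simp

theorem write_mk₁_cons (a b : Γ) (l : List Γ) :
    (Tape.mk₁ (b :: l)).write a = Tape.mk₁ (a :: l) := rfl

theorem move_left_mk₁ (l : List Γ) :
    (Tape.mk₁ l).move Dir.left = Tape.mk₁ (default :: l) := by
  simp only [Tape.mk₁, Tape.mk₂, Tape.move_left_mk']
  rfl

end Turing.Tape

namespace OneWayTM

/-- The head movement with the same effect as a movement of a two-way infinite tape. -/
def _root_.HeadMove.ofDir : Dir → HeadMove
  | Dir.left => .left
  | Dir.right => .right

theorem _root_.HeadMove.apply_ofDir (d : Dir) (T : Tape ℕ) :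
    (HeadMove.ofDir d).apply T = T.move d := by
  cases d <;> rfl

section Simulator

variable {Γ Λ : Type} [Inhabited Γ] [Inhabited Λ]
variable (M : TM0.Machine Γ Λ) (S : Finset Λ) (s : Λ → ℕ) (g : PointedMap Γ ℕ)

/-- The transition that simulates `M` in the state `q` scanning `a`, or leaves the simulation for
the state `0` if `M` halts. -/
def simTransition (q : Λ) (a : Γ) : TMTransition :=
  match M q a with
  | none => ⟨3 + s q, none, g a, 0, g a, .stay⟩
  | some (q', .move d) => ⟨3 + s q, none, g a, 3 + s q', g a, .ofDir d⟩
  | some (q', .write a') => ⟨3 + s q, none, g a, 3 + s q', g a', .stay⟩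

theorem simTransition_source (q : Λ) (a : Γ) : (simTransition M s g q a).source = 3 + s q := by
  unfold simTransition; split <;> rfl

theorem simTransition_scan (q : Λ) (a : Γ) : (simTransition M s g q a).scan = g a := by
  unfold simTransition; split <;> rfl

theorem simTransition_read (q : Λ) (a : Γ) : (simTransition M s g q a).read = none := by
  unfold simTransition; split <;> rfl

/-- The transitions from the states `0` and `1` scanning `c`: on each input letter the head moves
right and back; the end-marker leads to the final state `2`. -/
def bounceTransitions (c : ℕ) : List TMTransition :=
  [⟨0, some (some 0), c, 1, c, .right⟩, ⟨1, none, c, 0, c, .left⟩, ⟨0, some none, c, 2, c, .stay⟩]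

variable [Fintype Γ]

/-- The transitions that do not depend on the number of copies of the third symbol. -/
noncomputable def coreTransitions (N B : ℕ) (a₁ a₂ : ℕ) : List TMTransition :=
  ((S ×ˢ (Finset.univ : Finset Γ)).toList.map fun p => simTransition M s g p.1 p.2) ++
    ((List.range B).flatMap bounceTransitions ++
      [⟨3 + N, none, 0, 3 + s default, a₁, .stay⟩, ⟨3 + N + 1, none, 0, 3 + N, a₂, .left⟩])

/-- The `i`-th transition writing the symbol `b`. -/
def writeTransition (N b i : ℕ) : TMTransition :=
  ⟨3 + N + 1 + (i + 1), none, 0, 3 + N + 1 + i, b, .left⟩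

/-- A machine that writes `a₁`, `a₂` and `k` copies of `b` on its worktape, simulates `M`, and, if
`M` halts, accepts with two moves for each letter of its input. -/
noncomputable def simulator (N B : ℕ) (a₁ a₂ b : ℕ) (k : ℕ) : OneWayTM where
  -- States 0 and 1 bounce, 2 is final, `3 + s q` simulates `q`, `3 + N` writes `a₁`, `3 + N + 1`
  -- writes `a₂`, and `3 + N + 1 + i` with `i > 0` has `i` copies of `b` left to write. Writing goes
  -- from right to left, so the head ends on `a₁`.
  numStates := 3 + N + 1 + k + 1
  numInput := 1
  numTape := B
  start := 3 + N + 1 + k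
  final := [2]
  delta := coreTransitions M S s g N B a₁ a₂ ++ (List.range k).map (writeTransition N b)

variable {M S s g} {N B : ℕ} {a₁ a₂ b : Γ} {k : ℕ}

theorem mem_simulator_delta {a₁ a₂ b : ℕ} {t : TMTransition} :
    t ∈ (simulator M S s g N B a₁ a₂ b k).delta ↔
      (∃ q ∈ S, ∃ a, t = simTransition M s g q a) ∨
      (∃ c < B, t = ⟨0, some (some 0), c, 1, c, .right⟩) ∨
      (∃ c < B, t = ⟨1, none, c, 0, c, .left⟩) ∨
      (∃ c < B, t = ⟨0, some none, c, 2, c, .stay⟩) ∨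
      t = ⟨3 + N, none, 0, 3 + s default, a₁, .stay⟩ ∨
      t = ⟨3 + N + 1, none, 0, 3 + N, a₂, .left⟩ ∨
      ∃ i < k, t = writeTransition N b i := by
  simp only [simulator, coreTransitions, bounceTransitions, List.mem_append, List.mem_map,
    List.mem_flatMap, Finset.mem_toList, Finset.mem_product, Finset.mem_univ, Prod.exists,
    List.mem_range, List.mem_cons, List.not_mem_nil, or_false, and_true, eq_comm (a := t)]
  constructor
  · rintro ((⟨q, a, hq, h⟩ | ⟨c, hc, h | h | h⟩ | h | h) | ⟨i, hi, h⟩)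
    · exact .inl ⟨q, hq, a, h⟩
    · exact .inr (.inl ⟨c, hc, h⟩)
    · exact .inr (.inr (.inl ⟨c, hc, h⟩))
    · exact .inr (.inr (.inr (.inl ⟨c, hc, h⟩)))
    · exact .inr (.inr (.inr (.inr (.inl h))))
    · exact .inr (.inr (.inr (.inr (.inr (.inl h)))))
    · exact .inr (.inr (.inr (.inr (.inr (.inr ⟨i, hi, h⟩)))))
  · rintro (⟨q, hq, a, h⟩ | ⟨c, hc, h⟩ | ⟨c, hc, h⟩ | ⟨c, hc, h⟩ | h | h | ⟨i, hi, h⟩)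
    · exact .inl (.inl ⟨q, a, hq, h⟩)
    · exact .inl (.inr (.inl ⟨c, hc, .inl h⟩))
    · exact .inl (.inr (.inl ⟨c, hc, .inr (.inl h)⟩))
    · exact .inl (.inr (.inl ⟨c, hc, .inr (.inr h)⟩))
    · exact .inl (.inr (.inr (.inl h)))
    · exact .inl (.inr (.inr (.inr h)))
    · exact .inr ⟨i, hi, h⟩

theorem simulator_wellFormed (hM : TM0.Supports M (S : Set Λ)) (hs : ∀ q ∈ S, s q < N)
    (hg : ∀ a, g a < B) : (simulator M S s g N B (g a₁) (g a₂) (g b) k).WellFormed := by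
  have h0 := hs _ hM.1
  have hB : 0 < B := (Nat.zero_le _).trans_lt (hg default)
  refine ⟨hB, Nat.lt_succ_self _, ?_, ?_⟩
  · simp only [simulator, List.mem_singleton, forall_eq]; omega
  intro t ht
  rw [mem_simulator_delta] at ht
  have h1 := hg a₁
  have h2 := hg a₂
  have h3 := hg b
  rcases ht with ⟨q, hq, a, rfl⟩ | ⟨c, hc, rfl⟩ | ⟨c, hc, rfl⟩ | ⟨c, hc, rfl⟩ | rfl | rfl |
    ⟨i, hi, rfl⟩
  · have hq' := hs q hq
    have ha := hg a
    simp only [simTransition, simulator]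
    split
    · refine ⟨?_, ?_, ha, ha, by simp⟩ <;> simp only <;> omega
    · next q' d h =>
      have := hs _ (hM.2 h hq)
      refine ⟨?_, ?_, ha, ha, by simp⟩ <;> simp only <;> omega
    · next q' a' h =>
      have := hs _ (hM.2 h hq)
      refine ⟨?_, ?_, ha, hg a', by simp⟩ <;> simp only <;> omega
  all_goals simp [simulator, writeTransition]; try omega

/-- The bound `s q < N` keeps the groups of states disjoint, and injectivity of `s` on `S` and of
`g` separates the simulating transitions. Only state 0 has two transitions for one scanned symbol,
and these read a letter and the end-marker. -/
theorem simulator_deterministic (hs : ∀ q ∈ S, s q < N) (hsinj : Set.InjOn s S)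
    (hg : Function.Injective g) {a₁ a₂ b : ℕ} :
    (simulator M S s g N B a₁ a₂ b k).Deterministic := by
  intro t ht u hu hsrc hscan hread
  rw [mem_simulator_delta] at ht hu
  rcases ht with ⟨q, hq, a, rfl⟩ | ⟨c, hc, rfl⟩ | ⟨c, hc, rfl⟩ | ⟨c, hc, rfl⟩ | rfl | rfl |
      ⟨i, hi, rfl⟩ <;>
    rcases hu with ⟨q', hq', a', rfl⟩ | ⟨c', hc', rfl⟩ | ⟨c', hc', rfl⟩ | ⟨c', hc', rfl⟩ | rfl |
      rfl | ⟨i', hi', rfl⟩ <;>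
    simp only [simTransition_source, simTransition_scan, simTransition_read, writeTransition,
      reduceCtorEq, or_self, Option.some.injEq] at hsrc hscan hread ⊢
  case inl.inl =>
    rw [hg hscan, hsinj hq hq' (by omega)]
  all_goals try (have := hs q hq)
  all_goals try (have := hs q' hq')
  all_goals try subst hscan
  all_goals try rfl
  all_goals try omega
  all_goals
    obtain rfl : i = i' := by omega
    rfl

end Simulator

end OneWayTM

theorem Turing.TM0.dom_eval_iff {Γ Λ : Type*} [Inhabited Γ] [Inhabited Λ]
    {M : TM0.Machine Γ Λ} {l : List Γ} :
    (TM0.eval M l).Dom ↔ ∃ c, TM0.Reaches M (TM0.init l) c ∧ TM0.step M c = none := by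
  show (StateTransition.eval (TM0.step M) (TM0.init l)).Dom ↔ _
  rw [Part.dom_iff_mem]
  exact exists_congr fun c => StateTransition.mem_eval

/-! ### Halting yields accepting computations with arbitrarily many bounces -/

namespace OneWayTM

section Simulator

variable {Γ Λ : Type} [Inhabited Γ] [Inhabited Λ] [Fintype Γ]
variable {M : TM0.Machine Γ Λ} {S : Finset Λ} {s : Λ → ℕ} {g : PointedMap Γ ℕ}
variable {N B : ℕ} {a₁ a₂ b : Γ} {k : ℕ}

/-- The configuration of the simulator that corresponds to a configuration of `M`. -/
def simConfig (s : Λ → ℕ) (g : PointedMap Γ ℕ) (inp : List (Option ℕ)) (x : ℤ)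
    (c : TM0.Cfg Γ Λ) : TMConfig :=
  ⟨3 + s c.q, inp, c.Tape.map g, x⟩

theorem simulator_step_of_mem_step {a₁ a₂ b : ℕ} {c c' : TM0.Cfg Γ Λ} (hc : c.q ∈ S)
    (h : c' ∈ TM0.step M c) (inp : List (Option ℕ)) (x : ℤ) :
    ∃ x', (simulator M S s g N B a₁ a₂ b k).Step (simConfig s g inp x c)
      (simConfig s g inp x' c') := by
  obtain ⟨q, T⟩ := c
  obtain ⟨⟨q', st⟩, hq, rfl⟩ := Option.map_eq_some_iff.1 h
  have hmem : simTransition M s g q T.head ∈ (simulator M S s g N B a₁ a₂ b k).delta :=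
    mem_simulator_delta.2 (.inl ⟨q, hc, T.head, rfl⟩)
  refine ⟨x + (simTransition M s g q T.head).move.shift, _, hmem, simTransition_source .., ?_, ?_⟩
  · rw [simTransition_scan]; exact (Tape.map_fst g T).symm
  · rw [simTransition_read]
    refine ⟨rfl, ?_⟩
    unfold simTransition
    rcases st with d | a
    · simp only [hq]
      refine ⟨rfl, ?_, rfl⟩
      simp only [simConfig, HeadMove.apply_ofDir, Tape.map_move]
      rw [← Tape.map_fst g T, Tape.write_self]
    · simp only [hq]
      refine ⟨rfl, ?_, rfl⟩
      simp only [simConfig, HeadMove.apply, Tape.map_write]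

/-- The final address may be arbitrary: the later lower bounds count only the bounces after the
simulation. -/
theorem simulator_reflTransGen_of_reaches {a₁ a₂ b : ℕ} (hM : TM0.Supports M (S : Set Λ))
    {c c' : TM0.Cfg Γ Λ} (hc : c.q ∈ S) (h : TM0.Reaches M c c') (inp : List (Option ℕ)) (x : ℤ) :
    c'.q ∈ S ∧ ∃ x', Relation.ReflTransGen (simulator M S s g N B a₁ a₂ b k).Step
      (simConfig s g inp x c) (simConfig s g inp x' c') := by
  induction h with
  | refl => exact ⟨hc, x, .refl⟩
  | tail _ h ih =>
    obtain ⟨hq, x', hx⟩ := ih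
    obtain ⟨x'', hx'⟩ := simulator_step_of_mem_step (N := N) (B := B) (k := k) (s := s) (g := g)
      (a₁ := a₁) (a₂ := a₂) (b := b) hq h inp x'
    exact ⟨TM0.step_supports M hM h hq, x'', hx.tail hx'⟩

theorem simulator_step_halt {a₁ a₂ b : ℕ} {c : TM0.Cfg Γ Λ} (hc : c.q ∈ S)
    (h : TM0.step M c = none) (inp : List (Option ℕ)) (x : ℤ) :
    (simulator M S s g N B a₁ a₂ b k).Step (simConfig s g inp x c)
      ⟨0, inp, c.Tape.map g, x⟩ := by
  obtain ⟨q, T⟩ := c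
  have hq : M q T.head = none := Option.map_eq_none_iff.1 h
  have hmem : simTransition M s g q T.head ∈ (simulator M S s g N B a₁ a₂ b k).delta :=
    mem_simulator_delta.2 (.inl ⟨q, hc, T.head, rfl⟩)
  refine ⟨_, hmem, simTransition_source .., ?_, ?_⟩
  · rw [simTransition_scan]; exact (Tape.map_fst g T).symm
  · rw [simTransition_read]
    refine ⟨rfl, ?_⟩
    unfold simTransition
    simp only [hq]
    refine ⟨trivial, ?_, (add_zero x).symm⟩
    simp only [HeadMove.apply, simConfig]
    rw [← Tape.map_fst g T, Tape.write_self]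

theorem simulator_reflTransGen_init (w : List ℕ) :
    ∃ x, Relation.ReflTransGen (simulator M S s g N B (g a₁) (g a₂) (g b) k).Step
      ((simulator M S s g N B (g a₁) (g a₂) (g b) k).initial w)
      (simConfig s g (w.map some ++ [none]) x
        (TM0.init (a₁ :: a₂ :: List.replicate k b))) := by
  set W := simulator M S s g N B (g a₁) (g a₂) (g b) k with hW
  set inp := w.map some ++ [none]
  -- After `j` writes the head is on the blank cell just left of the `j` copies of `b`.
  have hwrite : ∀ j ≤ k, ∃ x, Relation.ReflTransGen W.Step (W.initial w)
      ⟨3 + N + 1 + (k - j), inp, Tape.mk₁ (0 :: List.replicate j (g b)), x⟩ := by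
    intro j hj
    induction j with
    | zero =>
      refine ⟨1, ?_⟩
      convert Relation.ReflTransGen.refl using 1
      rw [initial, Tape.mk₁_nil_eq_mk₁_default]
      rfl
    | succ j ih =>
      obtain ⟨x, hx⟩ := ih (by omega)
      refine ⟨x + -1, hx.tail ⟨writeTransition N (g b) (k - (j + 1)), ?_, ?_, rfl, rfl, rfl, ?_,
        rfl⟩⟩
      · exact mem_simulator_delta.2
          (.inr (.inr (.inr (.inr (.inr (.inr ⟨_, by omega, rfl⟩))))))
      · simp only [writeTransition]; omega
      · simp only [writeTransition, HeadMove.apply, Tape.write_mk₁_cons, Tape.move_left_mk₁,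
          List.replicate_succ]
        rfl
  obtain ⟨x, hx⟩ := hwrite k le_rfl
  rw [Nat.sub_self] at hx
  refine ⟨x + -1 + 0, (hx.tail (b := ⟨3 + N + 1, _, _, _⟩)
    (c := ⟨3 + N, inp, Tape.mk₁ (0 :: g a₂ :: List.replicate k (g b)), x + -1⟩) ?_).tail ?_⟩
  · refine ⟨_, mem_simulator_delta.2 (.inr (.inr (.inr (.inr (.inr (.inl rfl)))))), rfl, rfl, rfl,
      rfl, ?_, rfl⟩
    simp only [HeadMove.apply, Tape.write_mk₁_cons, Tape.move_left_mk₁]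
    rfl
  · refine ⟨_, mem_simulator_delta.2 (.inr (.inr (.inr (.inr (.inl rfl))))), rfl, rfl, rfl,
      rfl, ?_, rfl⟩
    simp only [HeadMove.apply, Tape.write_mk₁_cons, simConfig, TM0.init, Tape.map_mk₁,
      List.map_cons, List.map_replicate]

/-- The configurations of a computation that reads `m` letters with a move to the right and back for
each letter, and then the end-marker. -/
def bounceConfig (T : Tape ℕ) (m : ℕ) (x : ℤ) (j : ℕ) : TMConfig :=
  if j = 2 * m + 1 then ⟨2, [], T, x⟩
  else if j % 2 = 0 then ⟨0, List.replicate (m - j / 2) (some 0) ++ [none], T, x⟩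
  else ⟨1, List.replicate (m - j / 2 - 1) (some 0) ++ [none], T.move Dir.right, x + 1⟩

theorem simulator_step_bounceConfig {a₁ a₂ b : ℕ} (hg : ∀ a, g a < B) (T : Tape Γ) {m : ℕ} (x : ℤ)
    {j : ℕ} (hj : j < 2 * m + 1) :
    (simulator M S s g N B a₁ a₂ b k).Step (bounceConfig (T.map g) m x j)
      (bounceConfig (T.map g) m x (j + 1)) := by
  -- The tape is an image under `g`, so every scanned symbol is below `B` and has its bouncing
  -- transitions.
  have hhead : ∀ T : Tape Γ, (T.map g).head < B := fun T => by
    rw [Tape.map_fst]; exact hg _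
  have hright : ((T.map g).move Dir.right).head < B := by
    rw [← Tape.map_move]; exact hhead _
  obtain ⟨t, rfl | rfl⟩ := Nat.even_or_odd' j
  · rcases Nat.lt_or_ge t m with ht | ht
    · have h1 : bounceConfig (T.map g) m x (2 * t) =
          ⟨0, List.replicate (m - t) (some 0) ++ [none], T.map g, x⟩ := by
        rw [bounceConfig, if_neg (by omega), if_pos (by omega)]
        congr; omega
      have h2 : bounceConfig (T.map g) m x (2 * t + 1) =
          ⟨1, List.replicate (m - t - 1) (some 0) ++ [none], (T.map g).move Dir.right, x + 1⟩ := by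
        rw [bounceConfig, if_neg (by omega), if_neg (by omega)]
        congr; omega
      rw [h1, h2]
      refine ⟨_, mem_simulator_delta.2 (.inr (.inl ⟨_, hhead T, rfl⟩)), rfl, rfl, ?_, rfl, ?_, rfl⟩
      · obtain ⟨u, hu⟩ : ∃ u, m - t = u + 1 := ⟨m - t - 1, by omega⟩
        simp [hu, List.replicate_succ]
      · simp only [HeadMove.apply, Tape.write_self]
    · obtain rfl : t = m := by omega
      rw [bounceConfig, if_neg (by omega), if_pos (by omega), bounceConfig, if_pos rfl]
      refine ⟨_, mem_simulator_delta.2 (.inr (.inr (.inr (.inl ⟨_, hhead T, rfl⟩)))), rfl, rfl, ?_,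
        rfl, ?_, (add_zero x).symm⟩
      · simp
      · simp only [HeadMove.apply, Tape.write_self]
  · have h1 : bounceConfig (T.map g) m x (2 * t + 1) =
        ⟨1, List.replicate (m - t - 1) (some 0) ++ [none], (T.map g).move Dir.right, x + 1⟩ := by
      rw [bounceConfig, if_neg (by omega), if_neg (by omega)]
      congr; omega
    have h2 : bounceConfig (T.map g) m x (2 * t + 1 + 1) =
        ⟨0, List.replicate (m - t - 1) (some 0) ++ [none], T.map g, x⟩ := by
      rw [bounceConfig, if_neg (by omega), if_pos (by omega)]
      congr 3; omega
    rw [h1, h2]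
    refine ⟨_, mem_simulator_delta.2 (.inr (.inr (.inl ⟨_, hright, rfl⟩))), rfl, rfl, rfl,
      rfl, ?_, (add_neg_cancel_right x 1).symm⟩
    simp only [HeadMove.apply, Tape.write_self, Tape.move_right_left]

theorem _root_.Relation.ReflTransGen.exists_seq {α : Type*} {R : α → α → Prop} {x y : α}
    (h : Relation.ReflTransGen R x y) :
    ∃ (n : ℕ) (c : ℕ → α), c 0 = x ∧ c n = y ∧ ∀ j < n, R (c j) (c (j + 1)) := by
  induction h using Relation.ReflTransGen.head_induction_on with
  | refl => exact ⟨0, fun _ => y, rfl, rfl, by simp⟩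
  | @head a d hR _ ih =>
    obtain ⟨n, c, h0, hn, hc⟩ := ih
    refine ⟨n + 1, fun j => Nat.casesOn j a c, rfl, hn, fun j hj => ?_⟩
    cases j with
    | zero => simpa [h0] using hR
    | succ j => exact hc j (by omega)

/-- If `M` halts, then on each input word over a one-letter alphabet the simulator has an accepting
computation whose head bounces between two cells once for each letter. -/
theorem simulator_exists_accepting (hM : TM0.Supports M (S : Set Λ)) (hg : ∀ a, g a < B)
    (h : (TM0.eval M (a₁ :: a₂ :: List.replicate k b)).Dom) (m : ℕ) :
    ∃ (n : ℕ) (c : ℕ → TMConfig) (x : ℤ),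
      (simulator M S s g N B (g a₁) (g a₂) (g b) k).IsAcceptingComputation (List.replicate m 0)
        (n + (2 * m + 1)) c ∧
      (∀ t ≤ m, (c (n + 2 * t)).address = x) ∧ ∀ t < m, (c (n + 2 * t + 1)).address = x + 1 := by
  obtain ⟨d, hd, hhalt⟩ := TM0.dom_eval_iff.1 h
  set W := simulator M S s g N B (g a₁) (g a₂) (g b) k
  obtain ⟨x₀, h₀⟩ := simulator_reflTransGen_init (M := M) (S := S) (s := s) (g := g) (N := N)
    (B := B) (a₁ := a₁) (a₂ := a₂) (b := b) (k := k) (List.replicate m 0)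
  obtain ⟨hdS, x, h₁⟩ := simulator_reflTransGen_of_reaches (s := s) (g := g) (N := N)
    (B := B) (a₁ := g a₁) (a₂ := g a₂) (b := g b) (k := k) hM (show default ∈ S from hM.1) hd
    ((List.replicate m 0).map some ++ [none]) x₀
  have h₂ := (h₀.trans h₁).tail (simulator_step_halt hdS hhalt _ x)
  obtain ⟨n, c, hc0, hcn, hc⟩ := h₂.exists_seq
  rw [List.map_replicate] at hcn
  have hb0 : c n = bounceConfig (d.Tape.map g) m x 0 := by
    rw [hcn, bounceConfig, if_neg (by omega), if_pos rfl]; rfl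
  -- The computation up to halting and the bouncing phase are glued at time `n`, where they agree by
  -- `hb0`.
  let e : ℕ → TMConfig := fun j => if j < n then c j else bounceConfig (d.Tape.map g) m x (j - n)
  have hlt : ∀ j ≤ n, e j = c j := fun j hj => by
    rcases hj.lt_or_eq with h | rfl
    · exact if_pos h
    · simp only [e, lt_irrefl, if_false, Nat.sub_self, hb0]
  have hge : ∀ j, e (n + j) = bounceConfig (d.Tape.map g) m x j := fun j => by
    simp only [e]; rw [if_neg (by omega), Nat.add_sub_cancel_left]
  refine ⟨n, e, x, ⟨?_, ?_, ?_, ?_, ?_⟩, fun t ht => ?_, fun t ht => ?_⟩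
  · intro a ha
    rw [List.eq_of_mem_replicate ha]; exact Nat.one_pos
  · rw [hlt 0 (Nat.zero_le _), hc0]
  · intro j hj
    rcases Nat.lt_or_ge j n with h | h
    · rw [hlt j h.le, hlt (j + 1) h]; exact hc j h
    · obtain ⟨i, rfl⟩ := Nat.exists_eq_add_of_le h
      rw [hge, add_assoc, hge]
      exact simulator_step_bounceConfig hg _ _ (by omega)
  · rw [hge, bounceConfig, if_pos rfl]; exact List.mem_singleton.2 rfl
  · rw [hge, bounceConfig, if_pos rfl]
  · rw [hge, bounceConfig, if_neg (by omega), if_pos (by omega)]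
  · rw [add_assoc, hge, bounceConfig, if_neg (by omega), if_neg (by omega)]

/-! ### Without halting there is no accepting computation -/

/-- The configurations of the simulator that are reachable before or after `M` has halted. -/
def SimInvariant (M : TM0.Machine Γ Λ) (S : Finset Λ) (s : Λ → ℕ) (g : PointedMap Γ ℕ) (N : ℕ)
    (a₁ a₂ b : Γ) (k : ℕ) (c : TMConfig) : Prop :=
  (c.state ≤ 2 ∧ (TM0.eval M (a₁ :: a₂ :: List.replicate k b)).Dom) ∨
  (∃ d : TM0.Cfg Γ Λ, d.q ∈ S ∧ TM0.Reaches M (TM0.init (a₁ :: a₂ :: List.replicate k b)) d ∧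
    c.state = 3 + s d.q ∧ c.tape = d.Tape.map g) ∨
  (c.state = 3 + N ∧ c.tape = Tape.mk₁ (0 :: g a₂ :: List.replicate k (g b))) ∨
  (∃ i ≤ k, c.state = 3 + N + 1 + i ∧ c.tape = Tape.mk₁ (0 :: List.replicate (k - i) (g b)))

/-- The states 0, 1, 2 can be entered from outside only by a simulating transition with `M q a =
none`. The invariant then supplies a reachable configuration of `M` in state `q` scanning `a`, which
witnesses halting. Once halting is known, the tape no longer matters. -/
theorem SimInvariant.step (hM : TM0.Supports M (S : Set Λ)) (hs : ∀ q ∈ S, s q < N)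
    (hsinj : Set.InjOn s S) (hg : Function.Injective g) {c c' : TMConfig}
    (hc : SimInvariant M S s g N a₁ a₂ b k c)
    (h : (simulator M S s g N B (g a₁) (g a₂) (g b) k).Step c c') :
    SimInvariant M S s g N a₁ a₂ b k c' := by
  obtain ⟨t, ht, hsrc, hscan, -, hst, htape, -⟩ := h
  have hdom : t.source ≤ 2 → (TM0.eval M (a₁ :: a₂ :: List.replicate k b)).Dom := by
    intro hle
    rcases hc with ⟨-, h⟩ | ⟨d, -, -, h, -⟩ | ⟨h, -⟩ | ⟨i, -, h, -⟩
    · exact h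
    all_goals omega
  have hsim : ∀ q ∈ S, t.source = 3 + s q → ∃ T : Tape Γ,
      TM0.Reaches M (TM0.init (a₁ :: a₂ :: List.replicate k b)) ⟨q, T⟩ ∧ c.tape = T.map g := by
    intro q hq hle
    have hqN := hs q hq
    rcases hc with ⟨h, -⟩ | ⟨⟨q', T⟩, hq', hd, h, hT⟩ | ⟨h, -⟩ | ⟨i, -, h, -⟩
    · omega
    · obtain rfl : q = q' := hsinj hq hq' (by simp only at h; omega)
      exact ⟨T, hd, hT⟩
    all_goals omega
  rw [mem_simulator_delta] at ht
  rcases ht with ⟨q, hq, a, rfl⟩ | ⟨e, -, rfl⟩ | ⟨e, -, rfl⟩ | ⟨e, -, rfl⟩ | rfl | rfl |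
    ⟨i, hi, rfl⟩
  · obtain ⟨T, hT, hcT⟩ := hsim q hq (simTransition_source ..)
    rw [simTransition_scan, hcT, Tape.map_fst] at hscan
    obtain rfl : a = T.head := hg hscan
    rw [hcT] at htape
    unfold simTransition at hst htape
    split at hst
    · next hq' =>
      refine .inl ⟨hst ▸ Nat.zero_le _, TM0.dom_eval_iff.2 ⟨_, hT, ?_⟩⟩
      exact Option.map_eq_none_iff.2 hq'
    · next q' d hq' =>
      simp only [hq', HeadMove.apply_ofDir] at htape
      refine .inr (.inl ⟨⟨q', T.move d⟩, hM.2 hq' hq, hT.tail ?_, hst, ?_⟩)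
      · exact Option.map_eq_some_iff.2 ⟨_, hq', rfl⟩
      · rw [htape, Tape.map_move, ← Tape.map_fst g T, Tape.write_self]
    · next q' a' hq' =>
      simp only [hq', HeadMove.apply] at htape
      refine .inr (.inl ⟨⟨q', T.write a'⟩, hM.2 hq' hq, hT.tail ?_, hst, ?_⟩)
      · exact Option.map_eq_some_iff.2 ⟨_, hq', rfl⟩
      · rw [htape, Tape.map_write]
  · exact .inl ⟨hst.le.trans (by simp), hdom (by simp)⟩
  · exact .inl ⟨hst.le.trans (by simp), hdom (by simp)⟩
  · exact .inl ⟨hst.le.trans (by simp), hdom (by simp)⟩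
  · simp only at hsrc hst htape
    rcases hc with ⟨h, -⟩ | ⟨d, hd, -, h, -⟩ | ⟨h, hT⟩ | ⟨i, -, h, -⟩
    · omega
    · have := hs _ hd; omega
    · refine .inr (.inl ⟨TM0.init _, hM.1, .refl, hst, ?_⟩)
      rw [htape, hT]
      simp only [HeadMove.apply, Tape.write_mk₁_cons, TM0.init, Tape.map_mk₁,
        List.map_cons, List.map_replicate]
    · omega
  · simp only at hsrc hst htape
    rcases hc with ⟨h, -⟩ | ⟨d, hd, -, h, -⟩ | ⟨h, hT⟩ | ⟨i, -, h, hT⟩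
    · omega
    · have := hs _ hd; omega
    · omega
    · obtain rfl : i = 0 := by omega
      refine .inr (.inr (.inl ⟨hst, ?_⟩))
      rw [htape, hT]
      simp only [HeadMove.apply, Tape.write_mk₁_cons, Tape.move_left_mk₁]
      rfl
  · simp only [writeTransition] at hsrc hst htape
    rcases hc with ⟨h, -⟩ | ⟨d, hd, -, h, -⟩ | ⟨h, hT⟩ | ⟨i', hi', h, hT⟩
    · omega
    · have := hs _ hd; omega
    · omega
    · obtain rfl : i' = i + 1 := by omega
      refine .inr (.inr (.inr ⟨i, by omega, hst, ?_⟩))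
      obtain ⟨u, hu⟩ : ∃ u, k - i = u + 1 := ⟨k - i - 1, by omega⟩
      obtain hu' : k - (i + 1) = u := by omega
      rw [htape, hT, hu, hu']
      simp only [HeadMove.apply, Tape.write_mk₁_cons, Tape.move_left_mk₁, List.replicate_succ]
      rfl

theorem simulator_not_accepting (hM : TM0.Supports M (S : Set Λ)) (hs : ∀ q ∈ S, s q < N)
    (hsinj : Set.InjOn s S) (hg : Function.Injective g)
    (h : ¬ (TM0.eval M (a₁ :: a₂ :: List.replicate k b)).Dom) (w : List ℕ) (n : ℕ)
    (c : ℕ → TMConfig) :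
    ¬ (simulator M S s g N B (g a₁) (g a₂) (g b) k).IsAcceptingComputation w n c := by
  rintro ⟨-, h0, hstep, hfin, -⟩
  have hinv : ∀ j ≤ n, SimInvariant M S s g N a₁ a₂ b k (c j) := by
    intro j hj
    induction j with
    | zero =>
      refine .inr (.inr (.inr ⟨k, le_rfl, by rw [h0]; rfl, ?_⟩))
      rw [h0, Nat.sub_self, initial, Tape.mk₁_nil_eq_mk₁_default]
      rfl
    | succ j ih => exact (ih (by omega)).step hM hs hsinj hg (hstep j hj)
  have h2 : (c n).state = 2 := List.mem_singleton.1 hfin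
  rcases hinv n le_rfl with ⟨-, h'⟩ | ⟨d, -, -, h', -⟩ | ⟨h', -⟩ | ⟨i, -, h', -⟩
  · exact h h'
  all_goals omega

end Simulator

end OneWayTM

/-! ### Counting turns, crossings and visits of a bouncing head -/

section Bounce

variable {i : ℕ → ℤ} {n m : ℕ} {x : ℤ}

/-- Only the return to `x` at time `n + 2 * t + 2` is counted: it is a left move from a cell entered
from the left one step before. Whether a move to the right is also a turn is immaterial. -/
theorem le_numTurns_of_bounce (h0 : ∀ t ≤ m, i (n + 2 * t) = x)
    (h1 : ∀ t < m, i (n + 2 * t + 1) = x + 1) : m ≤ numTurns i (n + (2 * m + 1)) := by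
  classical
  rw [numTurns]
  refine (Finset.card_range m).symm.le.trans
    (Finset.card_le_card_of_injOn (fun t => n + 2 * t + 2) ?_ ?_)
  · intro t ht
    have ht : t < m := Finset.mem_range.1 ht
    have e0 := h0 t ht.le
    have e1 := h1 t ht
    have e2 := h0 (t + 1) ht
    rw [show n + 2 * (t + 1) = n + 2 * t + 2 by ring] at e2
    rw [Finset.mem_coe, Finset.mem_filter, Finset.mem_Icc]
    refine ⟨⟨Nat.succ_pos _, show n + 2 * t + 2 ≤ _ by omega⟩, .inl ?_⟩
    simp only [show n + 2 * t + 2 - 1 = n + 2 * t + 1 from rfl]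
    refine ⟨by omega, n + 2 * t, by omega, by omega, fun j hj hj' => ?_⟩
    rw [show j = n + 2 * t + 1 by omega]
  · intro t _ u _ h
    simp only at h
    omega

theorem le_numCrossings_of_bounce (h0 : ∀ t ≤ m, i (n + 2 * t) = x)
    (h1 : ∀ t < m, i (n + 2 * t + 1) = x + 1) : m ≤ numCrossings i (n + (2 * m + 1)) x := by
  refine (Finset.card_range m).symm.le.trans
    (Finset.card_le_card_of_injOn (fun t => n + 2 * t) ?_ ?_)
  · intro t ht
    have ht : t < m := Finset.mem_range.1 ht
    rw [Finset.mem_coe, Finset.mem_filter, Finset.mem_range]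
    exact ⟨show n + 2 * t < _ by omega, .inl ⟨h0 t ht.le, h1 t ht⟩⟩
  · intro t _ u _ h
    simp only at h
    omega

theorem le_numVisits_of_bounce (h0 : ∀ t ≤ m, i (n + 2 * t) = x) :
    m ≤ numVisits i (n + (2 * m + 1)) x := by
  refine (Finset.card_range m).symm.le.trans
    (Finset.card_le_card_of_injOn (fun t => n + 2 * t) ?_ ?_)
  · intro t ht
    have ht : t < m := Finset.mem_range.1 ht
    rw [Finset.mem_coe, Finset.mem_filter, Finset.mem_range]
    exact ⟨show n + 2 * t < _ by omega, h0 t ht.le⟩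
  · intro t _ u _ h
    simp only at h
    omega

end Bounce

/-! ### Computability of the reduction and conclusion -/

namespace OneWayTM

theorem primrec_writeTransition (N b : ℕ) : Primrec (writeTransition N b) := by
  have h : Primrec fun i : ℕ => TMTransition.equivProd (writeTransition N b i) :=
    Primrec.pair (Primrec.nat_add.comp (Primrec.const _) (Primrec.succ.comp Primrec.id))
      (Primrec.pair (Primrec.const _) (Primrec.pair (Primrec.const _)
        (Primrec.pair (Primrec.nat_add.comp (Primrec.const _) Primrec.id)
          (Primrec.pair (Primrec.const _) (Primrec.const _)))))
  exact (Primrec.of_equiv_iff TMTransition.equivProd).1 h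

/-- Everything but `k` is fixed, so `coreTransitions` is a constant list and no effectiveness of
`M`, `s` or `g` is required. -/
theorem primrec_simulator {Γ Λ : Type} [Inhabited Γ] [Inhabited Λ] [Fintype Γ]
    (M : TM0.Machine Γ Λ) (S : Finset Λ) (s : Λ → ℕ) (g : PointedMap Γ ℕ) (N B a₁ a₂ b : ℕ) :
    Primrec (simulator M S s g N B a₁ a₂ b) := by
  have h : Primrec fun k : ℕ => OneWayTM.equivProd (simulator M S s g N B a₁ a₂ b k) :=
    Primrec.pair (Primrec.succ.comp (Primrec.nat_add.comp (Primrec.const _) Primrec.id))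
      (Primrec.pair (Primrec.const _) (Primrec.pair (Primrec.const _)
        (Primrec.pair (Primrec.nat_add.comp (Primrec.const _) Primrec.id)
          (Primrec.pair (Primrec.const _) (Primrec.list_append.comp (Primrec.const _)
            (Primrec.list_map Primrec.list_range
              ((primrec_writeTransition N b).comp₂ Primrec₂.right)))))))
  exact (Primrec.of_equiv_iff OneWayTM.equivProd).1 h

end OneWayTM

/-- A computable sequence of machines such that it is undecidable which of them accept, and those
that accept bounce between two cells as often as one likes. -/
theorem OneWayDTM.exists_not_computable_accepting :
    ∃ (F : ℕ → OneWayDTM) (H : ℕ → Prop), Computable F ∧ ¬ ComputablePred H ∧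
      (∀ k, ¬ H k → ∀ w n c, ¬ (F k).val.IsAcceptingComputation w n c) ∧
      ∀ k, H k → ∀ m, ∃ (w : List ℕ) (n : ℕ) (c : ℕ → TMConfig) (x : ℤ),
        (F k).val.IsAcceptingComputation w (n + (2 * m + 1)) c ∧
        (∀ t ≤ m, (c (n + 2 * t)).address = x) ∧
        ∀ t < m, (c (n + 2 * t + 1)).address = x + 1 := by
  classical
  obtain ⟨Γ, _, _, Λ, _, M, S, a₁, a₂, b, hM, hn⟩ := TM0.exists_not_computable_halting
  -- The blank must become 0; the other symbols are numbered from 1, which makes `Fintype.card Γ +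
  -- 1` an upper bound.
  let g : PointedMap Γ ℕ :=
    ⟨fun a => if a = default then 0 else Fintype.equivFin Γ a + 1, if_pos rfl⟩
  have hg : ∀ a, g a = if a = default then 0 else (Fintype.equivFin Γ a : ℕ) + 1 := fun _ => rfl
  have hginj : Function.Injective g := by
    intro a a' h
    rw [hg, hg] at h
    split_ifs at h with h1 h2 h2
    · rw [h1, h2]
    · exact (Fintype.equivFin Γ).injective (Fin.ext (Nat.succ_injective h))
  have hgB : ∀ a, g a < Fintype.card Γ + 1 := by
    intro a
    rw [hg]
    split_ifs
    · omega
    · exact Nat.succ_lt_succ (Fintype.equivFin Γ a).isLt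
  let s : Λ → ℕ := fun q => if hq : q ∈ S then S.equivFin ⟨q, hq⟩ else 0
  have hs : ∀ q (hq : q ∈ S), s q = S.equivFin ⟨q, hq⟩ := fun q hq => dif_pos hq
  have hsN : ∀ q ∈ S, s q < S.card := fun q hq => by rw [hs q hq]; exact Fin.isLt _
  have hsinj : Set.InjOn s S := by
    intro q hq q' hq' h
    rw [hs q hq, hs q' hq'] at h
    exact congrArg Subtype.val (S.equivFin.injective (Fin.ext h))
  refine ⟨fun k => ⟨OneWayTM.simulator M S s g S.card (Fintype.card Γ + 1) (g a₁) (g a₂) (g b) k,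
    OneWayTM.simulator_wellFormed hM hsN hgB, OneWayTM.simulator_deterministic hsN hsinj hginj⟩,
    _, ?_, hn, fun k hk w n c => ?_, fun k hk m => ?_⟩
  · let : DecidablePred fun M : OneWayTM => M.WellFormed ∧ M.Deterministic := Classical.decPred _
    let := Primcodable.subtype
      (OneWayTM.primrecPred_wellFormed.and OneWayTM.primrecPred_deterministic)
    exact (Primrec.subtype_mk
      (hp := OneWayTM.primrecPred_wellFormed.and OneWayTM.primrecPred_deterministic)
      (OneWayTM.primrec_simulator M S s g _ _ _ _ _)).to_comp
  · exact OneWayTM.simulator_not_accepting hM hsN hsinj hginj hk w n c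
  · obtain ⟨n, c, x, h⟩ := OneWayTM.simulator_exists_accepting (s := s) (N := S.card) hM hgB hk m
    exact ⟨_, n, c, x, h⟩

theorem mainTheorem5 :
    (¬ ComputablePred fun M : OneWayDTM => M.val.IsKTurn 0) ∧
    (¬ ComputablePred fun M : OneWayDTM => M.val.IsKCrossing 0) ∧
    (¬ ComputablePred fun M : OneWayDTM => M.val.IsKVisit 1) ∧
    (¬ ComputablePred fun M : OneWayDTM => M.val.IsFiniteTurn) ∧
    (¬ ComputablePred fun M : OneWayDTM => M.val.IsFiniteCrossing) ∧
    (¬ ComputablePred fun M : OneWayDTM => M.val.IsFiniteVisit) := by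
  obtain ⟨F, H, hF, hH, hno, hyes⟩ := OneWayDTM.exists_not_computable_accepting
  have key : ∀ P : OneWayDTM → Prop, (∀ k, ¬ H k → P (F k)) → (∀ k, H k → ¬ P (F k)) →
      ¬ ComputablePred P := by
    intro P h1 h2 hP
    have hPF : ComputablePred fun k => P (F k) :=
      ComputablePred.computable_of_manyOneReducible ⟨F, hF, fun _ => Iff.rfl⟩ hP
    refine hH (hPF.not.of_eq fun k => ?_)
    exact ⟨fun h => by_contra fun hk => h (h1 k hk), h2 k⟩
  -- With `j + 1` bounces every bound `j` is exceeded, which refutes the fixed and the finite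
  -- versions together.
  have turn : ∀ k, H k → ∀ j, ¬ (F k).val.IsKTurn j := by
    intro k hk j hj
    obtain ⟨w, n, c, x, hacc, h0, h1⟩ := hyes k hk (j + 1)
    exact absurd ((le_numTurns_of_bounce (i := fun j => (c j).address) h0 h1).trans
      (hj w _ c hacc)) (by omega)
  have crossing : ∀ k, H k → ∀ j, ¬ (F k).val.IsKCrossing j := by
    intro k hk j hj
    obtain ⟨w, n, c, x, hacc, h0, h1⟩ := hyes k hk (j + 1)
    exact absurd ((le_numCrossings_of_bounce (i := fun j => (c j).address) h0 h1).trans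
      (hj w _ c hacc x)) (by omega)
  have visit : ∀ k, H k → ∀ j, ¬ (F k).val.IsKVisit j := by
    intro k hk j hj
    obtain ⟨w, n, c, x, hacc, h0, -⟩ := hyes k hk (j + 1)
    exact absurd ((le_numVisits_of_bounce (i := fun j => (c j).address) h0).trans
      (hj w _ c hacc x)) (by omega)
  refine ⟨key _ (fun k hk w n c h => (hno k hk w n c h).elim) fun k hk => turn k hk 0,
    key _ (fun k hk w n c h => (hno k hk w n c h).elim) fun k hk => crossing k hk 0,
    key _ (fun k hk w n c h => (hno k hk w n c h).elim) fun k hk => visit k hk 1,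
    key _ (fun k hk => ⟨0, fun w n c h => (hno k hk w n c h).elim⟩) fun k hk ⟨j, hj⟩ =>
      turn k hk j hj,
    key _ (fun k hk => ⟨0, fun w n c h => (hno k hk w n c h).elim⟩) fun k hk ⟨j, hj⟩ =>
      crossing k hk j hj,
    key _ (fun k hk => ⟨0, fun w n c h => (hno k hk w n c h).elim⟩) fun k hk ⟨j, hj⟩ =>
      visit k hk j hj⟩
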